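/- Let $0\le p<q$ with $q=1-p$, let $Y\subset\{1,2,3,\dots\}$ be finite or infinite, and put $Y'=Y\cup\{0\}$. ASEP is the exclusion process on $\{0,1\}^{\mathbb Z}$ in which a particle at a site $x$ attempts to jump to $x+1$ at rate $p$ and to $x-1$ at rate $q$; a jump to an occupied site is suppressed. In the basic coupling $(\eta_t,\zeta_t)$ of two ASEPs both processes use the same attempted jumps, each obeying its own exclusion rule. In ASEP with first and second class particles the attempt rates are the same; a particle jumps to an empty site, a first class particle that attempts to jump to a site occupied by a second class particle exchanges places with it, and all other attempts have no effect. All these processes are Markov processes with càdlàg paths, understood as solutions of the martingale problem for the corresponding generator on functions of finitely many sites. (1) Let $(\eta_t,\zeta_t)_{t\ge 0}$ evolve under the basic coupling with $\{x:\eta_0(x)=1\}=Y$ and $\{x:\zeta_0(x)=1\}=Y'$. Then $\eta$ is an ASEP started from $Y$, $\zeta$ is an ASEP started from $Y'$, and almost surely, for all $t\ge0$, $\eta_t\le\zeta_t$ and there is exactly one site $x$ with $\zeta_t(x)=1$ and $\eta_t(x)=0$. The process with first class particles at the sites $\{x:\eta_t(x)=1\}$ and a second class particle at the discrepancy is an ASEP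 with first and second class particles, started with first class particles at $Y$ and a single second class particle at $0$. (2) Conversely, consider an ASEP with first and second class particles started with first class particles at $Y$ and a single second class particle at $0$. Let $\eta_t$ be the configuration of its first class particles and $\zeta_t$ the configuration of all its particles. Then $(\eta_t,\zeta_t)$ evolves under the basic coupling with initial sites $Y$ and $Y'$, and almost surely there is exactly one second class particle at every time $t\ge 0$. (3) Let $X(t)$ be the position at time $t$ of the second class particle in the process of (2), and denote its law by $\mathbb P_Y$. Then for all $t\ge0$ and $x\in\mathbb Z$ $$\mathbb P_Y(X(t)=x)=\mathbb P_{Y'}(\zeta_t(x)=1)-\mathbb P_Y(\eta_t(x)=1),$$ where on the right $\zeta$ is any ASEP started from $Y'$ and $\eta$ is any ASEP started from $Y$. -/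

import Mathlib

open MeasureTheory Filter Topology
open scoped NNReal

/-! ### Nearest neighbour exclusion dynamics on `ℤ`

A configuration assigns to every site of `ℤ` a local state from a (finite, discrete) set `A`.
The dynamics is given by a rule `attempt x y : (ℤ → A) → (ℤ → A)`, the effect of an attempted
jump from site `x` to site `y`.  Attempts from `x` to `x + 1` occur at rate `p` and attempts from
`x` to `x - 1` occur at rate `q`, independently for all sites `x`. -/

/-- The generator `L f (ξ) = ∑ₓ p [f(ξ^{x→x+1}) - f(ξ)] + q [f(ξ^{x→x-1}) - f(ξ)]`, where
`ξ^{x→y} = attempt x y ξ`.  It is applied only to functions `f` of finitely many coordinates and to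
rules that change no site other than `x` and `y`, so that only finitely many terms are nonzero. -/
noncomputable def jumpGenerator {A : Type*} (attempt : ℤ → ℤ → (ℤ → A) → (ℤ → A)) (p q : ℝ)
    (f : (ℤ → A) → ℝ) (ξ : ℤ → A) : ℝ :=
  ∑' x : ℤ, (p * (f (attempt x (x + 1) ξ) - f ξ) + q * (f (attempt x (x - 1) ξ) - f ξ))

/-- `ξ` is a (realization of the) Markov process with generator `jumpGenerator attempt p q` and
initial configuration `ξ₀`: it has càdlàg paths (for the product topology on configurations), it
starts almost surely in `ξ₀`, and it solves the martingale problem for the generator: for every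
function `f` of finitely many coordinates, `f(ξ_t) - ∫₀ᵗ (L f)(ξ_s) ds` is a martingale, relative
to a filtration to which `ξ` is adapted. -/
structure IsJumpProcess {A : Type*} [TopologicalSpace A] [MeasurableSpace A]
    (attempt : ℤ → ℤ → (ℤ → A) → (ℤ → A)) (p q : ℝ)
    {Ω : Type*} [MeasurableSpace Ω] (P : Measure Ω)
    (ξ : ℝ≥0 → Ω → (ℤ → A)) (ξ₀ : ℤ → A) : Prop where
  right_continuous : ∀ ω t, ContinuousWithinAt (fun s => ξ s ω) (Set.Ici t) t
  left_limits : ∀ ω t, ∃ l, Tendsto (fun s => ξ s ω) (𝓝[<] t) (𝓝 l)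
  initial : ∀ᵐ ω ∂P, ξ 0 ω = ξ₀
  martingale_problem : ∃ ℱ : Filtration ℝ≥0 (inferInstance : MeasurableSpace Ω),
    (∀ t, Measurable[ℱ t] (ξ t)) ∧
    ∀ (f : (ℤ → A) → ℝ) (F : Finset ℤ), DependsOn f (F : Set ℤ) →
      Martingale (fun (t : ℝ≥0) ω =>
        f (ξ t ω) - ∫ s in (0 : ℝ)..t, jumpGenerator attempt p q f (ξ s.toNNReal ω)) ℱ P

/-! ### ASEP -/

/-- Configurations in `{0,1}^ℤ`: `true` (1) is an occupied site, `false` (0) an empty one. -/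
abbrev Config : Type := ℤ → Bool

/-- The configuration whose occupied sites are the elements of `Y`. -/
noncomputable def configOf (Y : Set ℤ) : Config := fun x => by
  classical exact decide (x ∈ Y)

/-- The exclusion rule: if there is a particle at `x` and `y` is empty, the particle moves from `x`
to `y`; otherwise nothing happens. -/
def exclusionAttempt (x y : ℤ) (η : Config) : Config :=
  if η x = true ∧ η y = false then η ∘ Equiv.swap x y else η

/-- `η` is an ASEP (rate `p` to the right, rate `q` to the left) with particles initially at the
sites in `Y`. -/
def IsASEP (p q : ℝ) {Ω : Type*} [MeasurableSpace Ω] (P : Measure Ω)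
    (η : ℝ≥0 → Ω → Config) (Y : Set ℤ) : Prop :=
  IsJumpProcess exclusionAttempt p q P η (configOf Y)

/-! ### Basic coupling -/

/-- Two configurations `η`, `ζ`, regarded as one configuration with local states in
`{0,1} × {0,1}`. -/
def pairConfig (η ζ : Config) : ℤ → Bool × Bool := fun x => (η x, ζ x)

/-- In the basic coupling the two exclusion processes use the same attempted jumps, so that
particles at the same site move together whenever both can move. -/
def basicCouplingAttempt (x y : ℤ) (σ : ℤ → Bool × Bool) : ℤ → Bool × Bool :=
  pairConfig (exclusionAttempt x y fun z => (σ z).1) (exclusionAttempt x y fun z => (σ z).2)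

/-- `(η, ζ)` evolve together under the basic coupling, with particles of `η` initially at `Y` and
particles of `ζ` initially at `Y'`. -/
def IsBasicCoupling (p q : ℝ) {Ω : Type*} [MeasurableSpace Ω] (P : Measure Ω)
    (η ζ : ℝ≥0 → Ω → Config) (Y Y' : Set ℤ) : Prop :=
  IsJumpProcess basicCouplingAttempt p q P (fun t ω => pairConfig (η t ω) (ζ t ω))
    (pairConfig (configOf Y) (configOf Y'))

/-! ### ASEP with first and second class particles -/

/-- The content of a site: a first class particle, a second class particle, or nothing. -/
inductive SiteState : Type
  | first
  | second
  | hole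
  deriving DecidableEq

instance : TopologicalSpace SiteState := ⊥

instance : DiscreteTopology SiteState := ⟨rfl⟩

instance : MeasurableSpace SiteState := ⊤

/-- Smaller rank means higher priority. -/
def SiteState.rank : SiteState → ℕ
  | .first => 0
  | .second => 1
  | .hole => 2

/-- A particle at `x` attempting to jump to `y` exchanges places with the content of `y` if it has
priority over it: every particle has priority over an empty site, a first class particle has
priority over a second class particle.  Otherwise nothing happens. -/
def twoClassAttempt (x y : ℤ) (ξ : ℤ → SiteState) : ℤ → SiteState :=
  if (ξ x).rank < (ξ y).rank then ξ ∘ Equiv.swap x y else ξ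

/-- The configuration with first class particles at the sites in `Y` and a single second class
particle at the origin (used for `0 ∉ Y`). -/
noncomputable def secondClassAtOrigin (Y : Set ℤ) : ℤ → SiteState := fun x => by
  classical exact if x ∈ Y then .first else if x = 0 then .second else .hole

/-- `ξ` is an ASEP with first and second class particles, with first class particles initially at
the sites in `Y` and a single second class particle initially at the origin. -/
def IsSecondClassASEP (p q : ℝ) {Ω : Type*} [MeasurableSpace Ω] (P : Measure Ω)
    (ξ : ℝ≥0 → Ω → (ℤ → SiteState)) (Y : Set ℤ) : Prop :=
  IsJumpProcess twoClassAttempt p q P ξ (secondClassAtOrigin Y)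

/-- First class particles at the particles of `η`, second class particles at the sites that are
occupied in `ζ` but not in `η`. -/
def classify (η ζ : Config) : ℤ → SiteState := fun x =>
  if η x = true then .first else if ζ x = true then .second else .hole

/-- The sites occupied by a first class particle. -/
def firstClassConfig (ξ : ℤ → SiteState) : Config := fun x => decide (ξ x = .first)

/-- The sites occupied by a particle of either class. -/
def occupiedConfig (ξ : ℤ → SiteState) : Config := fun x => decide (ξ x ≠ .hole)

/-! Site by site, a coupled state with η ≤ ζ is a two-class state: (1,1) is a first class particle,
(0,1) a second class particle, (0,0) a hole. This dictionary intertwines the basic coupling with the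
two-class rule, hence their generators, so `IsJumpProcess.map` carries solutions of one martingale
problem to the other. The coordinate projections yield the two ASEPs in the same way.

Infinitely many particles may jump in any time interval, so induction over jumps is not available.
Preservation of η ≤ ζ and of "at most one second class particle" instead follows from
`IsJumpProcess.ae_eq_zero`, a Gronwall iteration on expectations of indicators. The second class
particle could then only be lost to infinity. A tent function of width n evaluated at its position
has drift at most 3/n, and a maximal inequality rules out escape before any fixed time
(`IsSecondClassASEP.ae_exists`).

For the law of X(t): {X(t) = x} is almost surely the event that x is occupied, but not by a first
class particle. Since the ASEPs on the right are arbitrary, the martingale problem must determine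
one-site probabilities. This is `IsJumpProcess.meanAt_eq`, where iterating the generator determines
expectations over a short time, and the argument is restarted. -/

/-! ### Local rules and functions of finitely many sites -/

/-- A rule is local if an attempt from `x` to `y` changes only the sites `x` and `y`, and the new
state at a site depends only on the old states there and at `x` and `y`. -/
structure IsLocalRule {A : Type*} (attempt : ℤ → ℤ → (ℤ → A) → (ℤ → A)) : Prop where
  apply_of_ne : ∀ {x y z : ℤ} (ξ : ℤ → A), z ≠ x → z ≠ y → attempt x y ξ z = ξ z
  apply_congr : ∀ {x y z : ℤ} {ξ ξ' : ℤ → A}, ξ x = ξ' x → ξ y = ξ' y → ξ z = ξ' z →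
    attempt x y ξ z = attempt x y ξ' z

/-- The sites at distance at most one from `F`. -/
def siteNeighbors (F : Finset ℤ) : Finset ℤ :=
  F ∪ F.image (· + 1) ∪ F.image (· - 1)

lemma mem_siteNeighbors {F : Finset ℤ} {z : ℤ} :
    z ∈ siteNeighbors F ↔ z ∈ F ∨ z - 1 ∈ F ∨ z + 1 ∈ F := by
  simp only [siteNeighbors, Finset.mem_union, Finset.mem_image, or_assoc]
  refine or_congr_right (or_congr ⟨?_, fun h => ⟨_, h, by ring⟩⟩ ⟨?_, fun h => ⟨_, h, by ring⟩⟩)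
  · rintro ⟨a, ha, rfl⟩; simpa using ha
  · rintro ⟨a, ha, rfl⟩; simpa using ha

lemma subset_siteNeighbors (F : Finset ℤ) : F ⊆ siteNeighbors F := fun _ h =>
  mem_siteNeighbors.2 (Or.inl h)

lemma card_siteNeighbors_le (F : Finset ℤ) : (siteNeighbors F).card ≤ 3 * F.card := by
  have h1 := Finset.card_union_le (F ∪ F.image (· + 1)) (F.image (· - 1))
  have h2 := Finset.card_union_le F (F.image (· + 1))
  have h3 := Finset.card_image_le (s := F) (f := (· + 1))
  have h4 := Finset.card_image_le (s := F) (f := (· - 1))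
  unfold siteNeighbors
  omega

lemma siteNeighbors_Icc_subset (m : ℕ) :
    siteNeighbors (Finset.Icc (-(m : ℤ)) m) ⊆
      Finset.Icc (-((m + 1 : ℕ) : ℤ)) ((m + 1 : ℕ) : ℤ) := by
  intro z hz
  simp only [mem_siteNeighbors, Finset.mem_Icc] at hz ⊢
  push_cast
  omega

lemma siteNeighbors_mono {F G : Finset ℤ} (h : F ⊆ G) : siteNeighbors F ⊆ siteNeighbors G := by
  intro z hz
  rw [mem_siteNeighbors] at hz ⊢
  exact hz.imp (fun k => h k) (Or.imp (fun k => h k) (fun k => h k))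

lemma exists_subset_Icc_neg (F : Finset ℤ) : ∃ m : ℕ, F ⊆ Finset.Icc (-(m : ℤ)) m := by
  refine ⟨F.sup Int.natAbs, fun x hx => ?_⟩
  have := Finset.le_sup (f := Int.natAbs) hx
  rw [Finset.mem_Icc]
  omega

/-! ### The generator on functions of finitely many sites. -/

section Generator

variable {A : Type*} {attempt : ℤ → ℤ → (ℤ → A) → (ℤ → A)} {p q : ℝ} {f : (ℤ → A) → ℝ}
  {F : Finset ℤ}

lemma IsLocalRule.comp_eq (hl : IsLocalRule attempt) (hf : DependsOn f (F : Set ℤ)) {x y : ℤ}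
    (hx : x ∉ F) (hy : y ∉ F) (ξ : ℤ → A) : f (attempt x y ξ) = f ξ :=
  hf fun _ hi => hl.apply_of_ne ξ (fun h => hx (h ▸ hi)) (fun h => hy (h ▸ hi))

lemma jumpGenerator_eq_sum (hl : IsLocalRule attempt) (hf : DependsOn f (F : Set ℤ))
    {S : Finset ℤ} (hS : siteNeighbors F ⊆ S) (ξ : ℤ → A) :
    jumpGenerator attempt p q f ξ =
      ∑ x ∈ S, (p * (f (attempt x (x + 1) ξ) - f ξ) + q * (f (attempt x (x - 1) ξ) - f ξ)) := by
  refine tsum_eq_sum fun x hx => ?_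
  have hx' : x ∉ siteNeighbors F := fun h => hx (hS h)
  simp only [mem_siteNeighbors, not_or] at hx'
  rw [hl.comp_eq hf hx'.1 hx'.2.2, hl.comp_eq hf hx'.1 hx'.2.1]
  simp

/-- Only attempts from `siteNeighbors F` contribute, and their targets lie at most one site further
out; hence two layers. -/
lemma dependsOn_jumpGenerator (hl : IsLocalRule attempt) (hf : DependsOn f (F : Set ℤ)) :
    DependsOn (jumpGenerator attempt p q f) (siteNeighbors (siteNeighbors F) : Set ℤ) := by
  intro ξ ξ' h
  have key : ∀ x y, x ∈ siteNeighbors (siteNeighbors F) → y ∈ siteNeighbors (siteNeighbors F) →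
      f (attempt x y ξ) = f (attempt x y ξ') := fun x y hx hy => hf fun i hi =>
    hl.apply_congr (h x hx) (h y hy)
      (h i (subset_siteNeighbors _ (subset_siteNeighbors _ hi)))
  rw [jumpGenerator_eq_sum hl hf subset_rfl, jumpGenerator_eq_sum hl hf subset_rfl]
  refine Finset.sum_congr rfl fun x hx => ?_
  have h0 : f ξ = f ξ' := hf fun i hi => h i (subset_siteNeighbors _ (subset_siteNeighbors _ hi))
  rw [h0, key x (x + 1) (subset_siteNeighbors _ hx) (mem_siteNeighbors.2 (by simp [hx])),
    key x (x - 1) (subset_siteNeighbors _ hx) (mem_siteNeighbors.2 (by simp [hx]))]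

lemma abs_jumpGenerator_le (hl : IsLocalRule attempt) (hf : DependsOn f (F : Set ℤ))
    (hp : 0 ≤ p) (hq : 0 ≤ q) (hpq : p + q = 1) {M : ℝ} (hM : ∀ ξ, |f ξ| ≤ M)
    {S : Finset ℤ} (hS : siteNeighbors F ⊆ S) (ξ : ℤ → A) :
    |jumpGenerator attempt p q f ξ| ≤ S.card * (2 * M) := by
  rw [jumpGenerator_eq_sum hl hf hS, ← nsmul_eq_mul]
  refine (Finset.abs_sum_le_sum_abs _ _).trans (Finset.sum_le_card_nsmul _ _ _ fun x _ => ?_)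
  have h1 := abs_le.1 (hM ξ)
  have h2 := abs_le.1 (hM (attempt x (x + 1) ξ))
  have h3 := abs_le.1 (hM (attempt x (x - 1) ξ))
  rw [abs_le]
  constructor <;> nlinarith

end Generator

/-! ### Regularity of functions of finitely many sites. -/

section Cylinder

variable {A : Type*} {f : (ℤ → A) → ℝ} {F : Finset ℤ}

lemma DependsOn.continuous_of_finset [TopologicalSpace A] [DiscreteTopology A]
    (hf : DependsOn f (F : Set ℤ)) : Continuous f := by
  obtain ⟨g, rfl⟩ := dependsOn_iff_exists_comp.1 hf
  exact continuous_of_discreteTopology.comp (by unfold Set.domRestrict; fun_prop)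

lemma DependsOn.measurable_of_finset [Finite A] [MeasurableSpace A] [MeasurableSingletonClass A]
    (hf : DependsOn f (F : Set ℤ)) : Measurable f := by
  obtain ⟨g, rfl⟩ := dependsOn_iff_exists_comp.1 hf
  exact (measurable_of_finite g).comp (by unfold Set.domRestrict; fun_prop)

lemma DependsOn.exists_bound [Finite A] (hf : DependsOn f (F : Set ℤ)) :
    ∃ M, 0 ≤ M ∧ ∀ ξ, |f ξ| ≤ M := by
  obtain ⟨g, rfl⟩ := dependsOn_iff_exists_comp.1 hf
  obtain ⟨M, hM⟩ := (Set.finite_range fun x => |g x|).bddAbove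
  exact ⟨max M 0, le_max_right _ _, fun ξ => (hM ⟨_, rfl⟩).trans (le_max_left _ _)⟩

end Cylinder

/-! ### Right-continuous paths -/

/-- The `+ 1` keeps the grid points at or above `s`, the side from which right-continuous paths can
be approximated. -/
lemma tendsto_floor_add_one_div (s : ℝ≥0) :
    Tendsto (fun n : ℕ => ((⌊(n + 1 : ℝ≥0) * s⌋₊ + 1 : ℕ) : ℝ≥0) / (n + 1)) atTop (𝓝[≥] s) := by
  have hle : ∀ n : ℕ, s ≤ ((⌊(n + 1 : ℝ≥0) * s⌋₊ + 1 : ℕ) : ℝ≥0) / (n + 1) := fun n => by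
    rw [le_div_iff₀ (by positivity), mul_comm]
    push_cast
    exact (Nat.lt_floor_add_one _).le
  refine tendsto_nhdsWithin_iff.2 ⟨?_, Eventually.of_forall hle⟩
  have hlim : Tendsto (fun n : ℕ => s + 1 / ((n : ℝ≥0) + 1)) atTop (𝓝 s) := by
    simpa using tendsto_const_nhds.add (tendsto_one_div_add_atTop_nhds_zero_nat (𝕜 := ℝ≥0))
  refine tendsto_of_tendsto_of_tendsto_of_le_of_le tendsto_const_nhds hlim hle fun n => ?_
  rw [div_le_iff₀ (by positivity), add_mul s, one_div_mul_cancel (by positivity), mul_comm s]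
  push_cast
  gcongr
  exact Nat.floor_le (by positivity)

/-- Stopping at `T` uses only the past up to `T`, so the lemma also applies with the σ-algebra at
time `T` of a filtration; adaptedness of the time integral rests on this. -/
lemma measurable_stopped_path {Ω : Type*} [MeasurableSpace Ω] {φ : ℝ≥0 → Ω → ℝ} (T : ℝ≥0)
    (hm : ∀ s ≤ T, Measurable (φ s))
    (hc : ∀ ω t, ContinuousWithinAt (fun s => φ s ω) (Set.Ici t) t) :
    Measurable fun z : Ω × ℝ≥0 => φ (min z.2 T) z.1 := by
  let ψ : ℕ → Ω × ℕ → ℝ := fun n w => φ (min (((w.2 + 1 : ℕ) : ℝ≥0) / (n + 1)) T) w.1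
  have hψ : ∀ n, Measurable (ψ n) := fun n =>
    measurable_from_prod_countable_left fun k =>
      hm (min (((k + 1 : ℕ) : ℝ≥0) / (n + 1)) T) (min_le_right _ _)
  refine measurable_of_tendsto_metrizable
    (f := fun n z => ψ n (z.1, ⌊((n : ℝ≥0) + 1) * z.2⌋₊)) (fun n => ?_) ?_
  · exact (hψ n).comp (measurable_fst.prodMk
      (Nat.measurable_floor.comp (measurable_snd.const_mul ((n : ℝ≥0) + 1))))
  · refine tendsto_pi_nhds.2 fun z => ?_
    have h1 := tendsto_nhdsWithin_iff.1 (tendsto_floor_add_one_div z.2)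
    have h2 : Tendsto (fun n : ℕ => min
        (((⌊((n : ℝ≥0) + 1) * z.2⌋₊ + 1 : ℕ) : ℝ≥0) / (n + 1)) T) atTop (𝓝[≥] (min z.2 T)) :=
      tendsto_nhdsWithin_iff.2
        ⟨h1.1.min tendsto_const_nhds, h1.2.mono fun n hn => min_le_min_right T hn⟩
    exact Tendsto.comp (hc z.1 (min z.2 T)) h2

lemma measurable_stopped_path_real {Ω : Type*} [MeasurableSpace Ω] {φ : ℝ≥0 → Ω → ℝ} (T : ℝ≥0)
    (hm : ∀ s ≤ T, Measurable (φ s))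
    (hc : ∀ ω t, ContinuousWithinAt (fun s => φ s ω) (Set.Ici t) t) :
    Measurable fun z : Ω × ℝ => φ (min z.2.toNNReal T) z.1 :=
  (measurable_stopped_path T hm hc).comp
    (measurable_fst.prodMk (measurable_real_toNNReal.comp measurable_snd))

lemma intervalIntegral_eq_stopped {φ : ℝ≥0 → ℝ} {a : ℝ} (T : ℝ≥0) (ha : a ≤ T) :
    ∫ s in a..(T : ℝ), φ s.toNNReal = ∫ s in a..(T : ℝ), φ (min s.toNNReal T) := by
  refine intervalIntegral.integral_congr fun s hs => ?_
  rw [Set.uIcc_of_le ha] at hs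
  have : s.toNNReal ≤ T := Real.toNNReal_le_iff_le_coe.2 hs.2
  simp [min_eq_left this]

lemma stronglyMeasurable_integral_path {Ω : Type*} [MeasurableSpace Ω] {φ : ℝ≥0 → Ω → ℝ}
    (T : ℝ≥0) (hm : ∀ s ≤ T, Measurable (φ s))
    (hc : ∀ ω t, ContinuousWithinAt (fun s => φ s ω) (Set.Ici t) t) :
    StronglyMeasurable fun ω => ∫ s in (0 : ℝ)..T, φ s.toNNReal ω := by
  have h : (fun ω => ∫ s in (0 : ℝ)..T, φ s.toNNReal ω) = fun ω =>
      ∫ s in Set.Ioc (0 : ℝ) T, φ (min s.toNNReal T) ω := funext fun ω => by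
    rw [intervalIntegral_eq_stopped (φ := fun s => φ s ω) T T.coe_nonneg,
      intervalIntegral.integral_of_le T.coe_nonneg]
  rw [h]
  exact (measurable_stopped_path_real T hm hc).stronglyMeasurable.integral_prod_right'

lemma measurable_path_real {Ω : Type*} [MeasurableSpace Ω] {φ : ℝ≥0 → Ω → ℝ}
    (hm : ∀ s, Measurable (φ s))
    (hc : ∀ ω t, ContinuousWithinAt (fun s => φ s ω) (Set.Ici t) t) :
    Measurable fun z : Ω × ℝ => φ z.2.toNNReal z.1 := by
  refine measurable_of_tendsto_metrizable
    (fun n : ℕ => measurable_stopped_path_real (n : ℝ≥0) (fun s _ => hm s) hc) ?_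
  refine tendsto_pi_nhds.2 fun z => tendsto_const_nhds.congr' ?_
  obtain ⟨N, hN⟩ := exists_nat_ge z.2.toNNReal
  filter_upwards [eventually_ge_atTop N] with n hn
  rw [min_eq_left (hN.trans (by exact_mod_cast hn))]

/-! ### Expectations along a jump process -/

/-- The expectation of `f (ξ_t)`, as a function of the real time `t`. -/
noncomputable def meanAt {A Ω : Type*} [MeasurableSpace Ω] (P : Measure Ω)
    (ξ : ℝ≥0 → Ω → (ℤ → A)) (f : (ℤ → A) → ℝ) (t : ℝ) : ℝ :=
  ∫ ω, f (ξ t.toNNReal ω) ∂P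

lemma abs_meanAt_le {A Ω : Type*} [MeasurableSpace Ω] {P : Measure Ω} [IsProbabilityMeasure P]
    {ξ : ℝ≥0 → Ω → (ℤ → A)} {f : (ℤ → A) → ℝ} {M : ℝ} (hM : ∀ ξ, |f ξ| ≤ M) (t : ℝ) :
    |meanAt P ξ f t| ≤ M := by
  simpa [meanAt] using norm_integral_le_of_norm_le_const (μ := P)
    (f := fun ω => f (ξ t.toNNReal ω)) (Eventually.of_forall fun ω => hM (ξ t.toNNReal ω))

/-- One induction step for bounds of the form `s ^ n / n!`: integration raises the power and
contributes the factor `1 / (n + 1)`. -/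
lemma integral_le_of_le_pow {g : ℝ → ℝ} {a s C : ℝ} {n : ℕ} (hs : 0 ≤ s)
    (hg : IntervalIntegrable g volume a (a + s))
    (h : ∀ r ∈ Set.Icc a (a + s), g r ≤ C * (r - a) ^ n) :
    ∫ r in a..(a + s), g r ≤ C / (n + 1) * s ^ (n + 1) := by
  have h1 : ∫ r in a..(a + s), C * (r - a) ^ n = C / (n + 1) * s ^ (n + 1) := by
    rw [intervalIntegral.integral_const_mul,
      intervalIntegral.integral_comp_sub_right (fun r => r ^ n) a, integral_pow]
    simp
    ring
  rw [← h1]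
  exact intervalIntegral.integral_mono_on (by linarith) hg
    (Continuous.intervalIntegrable (by fun_prop) _ _) h

section Paths

variable {A : Type*} [TopologicalSpace A] [MeasurableSpace A]
  {attempt : ℤ → ℤ → (ℤ → A) → (ℤ → A)} {p q : ℝ}
  {Ω : Type*} [MeasurableSpace Ω] {P : Measure Ω}
  {ξ : ℝ≥0 → Ω → (ℤ → A)} {ξ₀ : ℤ → A} {f : (ℤ → A) → ℝ} {F : Finset ℤ}

lemma IsJumpProcess.measurable (h : IsJumpProcess attempt p q P ξ ξ₀) (t : ℝ≥0) :
    Measurable (ξ t) := by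
  obtain ⟨ℱ, hℱ, -⟩ := h.martingale_problem
  exact (hℱ t).mono (ℱ.le t) le_rfl

lemma IsJumpProcess.continuousWithinAt_comp [DiscreteTopology A]
    (h : IsJumpProcess attempt p q P ξ ξ₀) (hf : DependsOn f (F : Set ℤ)) (ω : Ω) (t : ℝ≥0) :
    ContinuousWithinAt (fun s => f (ξ s ω)) (Set.Ici t) t :=
  hf.continuous_of_finset.continuousAt.comp_continuousWithinAt (h.right_continuous ω t)

lemma IsJumpProcess.integrable_comp [Finite A] [MeasurableSingletonClass A]
    [IsProbabilityMeasure P] (h : IsJumpProcess attempt p q P ξ ξ₀)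
    (hf : DependsOn f (F : Set ℤ)) (t : ℝ≥0) : Integrable (fun ω => f (ξ t ω)) P := by
  obtain ⟨M, -, hM⟩ := hf.exists_bound
  exact Integrable.of_bound
    (hf.measurable_of_finset.comp (h.measurable t)).aestronglyMeasurable M
    (Eventually.of_forall fun ω => hM _)

/-- An event about finitely many sites that has full probability at each fixed time holds almost
surely at all times simultaneously. -/
theorem IsJumpProcess.ae_forall_eq_zero [DiscreteTopology A]
    (h : IsJumpProcess attempt p q P ξ ξ₀)
    {f : (ℤ → A) → ℝ} {F : Finset ℤ} (hf : DependsOn f (F : Set ℤ))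
    (h0 : ∀ t, ∀ᵐ ω ∂P, f (ξ t ω) = 0) : ∀ᵐ ω ∂P, ∀ t, f (ξ t ω) = 0 := by
  obtain ⟨D, hDc, hD⟩ := TopologicalSpace.exists_countable_dense ℝ≥0
  filter_upwards [(ae_ball_iff hDc).2 fun t _ => h0 t] with ω hω t
  -- Right-continuity requires exceptional times to be approached from the right, so the dense times
  -- are taken strictly after `t`.
  have hcl : t ∈ closure (Set.Ioi t ∩ D) :=
    closure_minimal (hD.open_subset_closure_inter isOpen_Ioi) isClosed_closure
      (by rw [closure_Ioi]; exact Set.self_mem_Ici)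
  have := ((h.continuousWithinAt_comp hf ω t).mono
    (Set.inter_subset_left.trans Set.Ioi_subset_Ici_self)).mem_closure (t := {0}) hcl
    fun s hs => hω s hs.2
  simpa using this

end Paths

section Expectation

variable {A : Type*} [Finite A] [TopologicalSpace A] [DiscreteTopology A] [MeasurableSpace A]
  [MeasurableSingletonClass A] {attempt : ℤ → ℤ → (ℤ → A) → (ℤ → A)} {p q : ℝ}
  {Ω : Type*} [MeasurableSpace Ω] {P : Measure Ω}
  {ξ : ℝ≥0 → Ω → (ℤ → A)} {ξ₀ : ℤ → A} {f : (ℤ → A) → ℝ} {F : Finset ℤ}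

lemma IsJumpProcess.measurable_comp_real (h : IsJumpProcess attempt p q P ξ ξ₀)
    (hf : DependsOn f (F : Set ℤ)) : Measurable fun z : Ω × ℝ => f (ξ z.2.toNNReal z.1) :=
  measurable_path_real (φ := fun s ω => f (ξ s ω))
    (fun s => hf.measurable_of_finset.comp (h.measurable s)) (h.continuousWithinAt_comp hf)

variable [IsProbabilityMeasure P]

lemma IsJumpProcess.intervalIntegrable_meanAt (h : IsJumpProcess attempt p q P ξ ξ₀)
    (hf : DependsOn f (F : Set ℤ)) (a b : ℝ) :
    IntervalIntegrable (meanAt P ξ f) volume a b := by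
  obtain ⟨M, -, hM⟩ := hf.exists_bound
  refine (intervalIntegrable_const (c := M)).mono_fun ?_
    (Eventually.of_forall fun s => (abs_meanAt_le hM s).trans (le_abs_self M))
  exact ((h.measurable_comp_real hf).stronglyMeasurable.integral_prod_left'
    (μ := P)).aestronglyMeasurable

/-- Dynkin's formula: equate the means of the martingale at times `0` and `t`, then apply Fubini. -/
lemma IsJumpProcess.meanAt_eq_initial_add (h : IsJumpProcess attempt p q P ξ ξ₀)
    (hl : IsLocalRule attempt) (hf : DependsOn f (F : Set ℤ)) {t : ℝ} (ht : 0 ≤ t) :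
    meanAt P ξ f t =
      f ξ₀ + ∫ s in (0 : ℝ)..t, meanAt P ξ (jumpGenerator attempt p q f) s := by
  obtain ⟨ℱ, -, hM⟩ := h.martingale_problem
  lift t to ℝ≥0 using ht
  have hg := dependsOn_jumpGenerator (p := p) (q := q) hl hf
  obtain ⟨M, -, hMb⟩ := hg.exists_bound
  have hint : Integrable (Function.uncurry fun (s : ℝ) ω =>
      jumpGenerator attempt p q f (ξ s.toNNReal ω))
      ((volume.restrict (Set.uIoc 0 (t : ℝ))).prod P) := by
    rw [Set.uIoc_of_le t.coe_nonneg]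
    refine Integrable.of_bound
      ((h.measurable_comp_real hg).comp measurable_swap).aestronglyMeasurable M
      (Eventually.of_forall fun z => hMb _)
  have hint' : Integrable (fun ω => ∫ s in (0 : ℝ)..t,
      jumpGenerator attempt p q f (ξ s.toNNReal ω)) P := by
    simpa [intervalIntegral.integral_of_le t.coe_nonneg, Set.uIoc_of_le t.coe_nonneg]
      using hint.integral_prod_right
  have hm := (hM f F hf).setIntegral_eq (zero_le : 0 ≤ t) MeasurableSet.univ
  simp only [setIntegral_univ, NNReal.coe_zero, intervalIntegral.integral_same, sub_zero] at hm
  rw [integral_sub (h.integrable_comp hf t) hint'] at hm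
  have h0 : ∫ ω, f (ξ 0 ω) ∂P = f ξ₀ := by
    rw [integral_congr_ae (h.initial.mono fun ω hω => congrArg f hω)]
    simp
  rw [h0, ← intervalIntegral_integral_swap hint] at hm
  simp only [meanAt, Real.toNNReal_coe]
  linarith

lemma IsJumpProcess.meanAt_eq_add (h : IsJumpProcess attempt p q P ξ ξ₀)
    (hl : IsLocalRule attempt) (hf : DependsOn f (F : Set ℤ)) {a t : ℝ} (ha : 0 ≤ a)
    (ht : a ≤ t) :
    meanAt P ξ f t =
      meanAt P ξ f a + ∫ s in a..t, meanAt P ξ (jumpGenerator attempt p q f) s := by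
  have hg := dependsOn_jumpGenerator (p := p) (q := q) hl hf
  rw [h.meanAt_eq_initial_add hl hf ha, h.meanAt_eq_initial_add hl hf (ha.trans ht), add_assoc,
    intervalIntegral.integral_add_adjacent_intervals (h.intervalIntegrable_meanAt hg _ _)
      (h.intervalIntegrable_meanAt hg _ _)]

end Expectation

/-! ### Uniqueness of the one-dimensional marginals -/

section Uniqueness

/-- Bound, up to the factor `M`, for the `n`-th power of the generator applied to a function
of the sites in `[-m, m]` that is bounded by `M`. -/
def generatorPowBound (n m : ℕ) : ℝ :=
  ∏ i ∈ Finset.range n, (2 * (2 * ((m : ℝ) + 2 * i) + 3))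

lemma generatorPowBound_succ (n m : ℕ) :
    generatorPowBound (n + 1) m = generatorPowBound n (m + 2) * (2 * (2 * (m : ℝ) + 3)) := by
  rw [generatorPowBound, Finset.prod_range_succ', generatorPowBound]
  congr 1
  · refine Finset.prod_congr rfl fun i _ => ?_
    push_cast
    ring
  · simp

/-- The factors grow like `8 n`, because each generator widens the interval, so the factorial wins
only for small `s`: the ratio of consecutive terms tends to `8 * s ≤ 1 / 2`. -/
lemma tendsto_generatorPowBound (m : ℕ) {s : ℝ} (hs : 0 < s) (hs' : s ≤ 1 / 16) :
    Tendsto (fun n => generatorPowBound n m / n.factorial * s ^ n) atTop (𝓝 0) := by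
  have hpos : ∀ n, 0 < generatorPowBound n m := fun n => Finset.prod_pos fun i _ => by positivity
  refine (summable_of_ratio_test_tendsto_lt_one (l := 8 * s) (by linarith)
    (Eventually.of_forall fun n => ?_) ?_).tendsto_atTop_zero
  · have := hpos n
    positivity
  · have h1 : ∀ n : ℕ, ‖generatorPowBound (n + 1) m / (n + 1).factorial * s ^ (n + 1)‖ /
        ‖generatorPowBound n m / n.factorial * s ^ n‖ =
        (8 + (4 * m - 2) * (1 / ((n : ℝ) + 1))) * s := fun n => by
      have := hpos n
      have := hpos (n + 1)
      rw [Real.norm_of_nonneg (by positivity), Real.norm_of_nonneg (by positivity),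
        generatorPowBound, Finset.prod_range_succ, ← generatorPowBound, Nat.factorial_succ]
      push_cast
      field_simp
      ring
    simp_rw [h1]
    simpa using ((tendsto_one_div_add_atTop_nhds_zero_nat (𝕜 := ℝ)).const_mul
      (4 * (m : ℝ) - 2)).const_add 8 |>.mul_const s

variable {A : Type*} [Finite A] [TopologicalSpace A] [DiscreteTopology A] [MeasurableSpace A]
  [MeasurableSingletonClass A] {attempt : ℤ → ℤ → (ℤ → A) → (ℤ → A)} {p q : ℝ}
  {Ω₁ Ω₂ : Type*} [MeasurableSpace Ω₁] [MeasurableSpace Ω₂]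
  {P₁ : Measure Ω₁} [IsProbabilityMeasure P₁] {P₂ : Measure Ω₂} [IsProbabilityMeasure P₂]
  {ξ₁ : ℝ≥0 → Ω₁ → (ℤ → A)} {ξ₂ : ℝ≥0 → Ω₂ → (ℤ → A)} {ξ₀ : ℤ → A}

/-- Dynkin's formula from the time `a`, where the marginals agree, reduces the difference for `f` to
an integral of differences for its generator, to which the induction hypothesis applies. -/
lemma abs_meanAt_sub_le (h₁ : IsJumpProcess attempt p q P₁ ξ₁ ξ₀)
    (h₂ : IsJumpProcess attempt p q P₂ ξ₂ ξ₀) (hl : IsLocalRule attempt)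
    (hp : 0 ≤ p) (hq : 0 ≤ q) (hpq : p + q = 1) {a : ℝ} (ha : 0 ≤ a)
    (hD : ∀ (f : (ℤ → A) → ℝ) (F : Finset ℤ), DependsOn f (F : Set ℤ) →
      meanAt P₁ ξ₁ f a = meanAt P₂ ξ₂ f a) (n : ℕ) :
    ∀ (m : ℕ) (f : (ℤ → A) → ℝ) (M : ℝ),
      DependsOn f (Finset.Icc (-(m : ℤ)) m : Set ℤ) → (∀ ξ, |f ξ| ≤ M) → ∀ s, 0 ≤ s →
      |meanAt P₁ ξ₁ f (a + s) - meanAt P₂ ξ₂ f (a + s)| ≤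
        2 * M * (generatorPowBound n m / n.factorial) * s ^ n := by
  induction n with
  | zero =>
    intro m f M _ hM s _
    have h1 := abs_le.1 (abs_meanAt_le (P := P₁) (ξ := ξ₁) hM (a + s))
    have h2 := abs_le.1 (abs_meanAt_le (P := P₂) (ξ := ξ₂) hM (a + s))
    simp only [generatorPowBound, Finset.range_zero, Finset.prod_empty, Nat.factorial_zero,
      Nat.cast_one, div_one, mul_one, pow_zero]
    rw [abs_le]
    constructor <;> linarith
  | succ n ih =>
    intro m f M hf hM s hs
    have hg := dependsOn_jumpGenerator (p := p) (q := q) hl hf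
    have hg' : DependsOn (jumpGenerator attempt p q f)
        (Finset.Icc (-((m + 2 : ℕ) : ℤ)) ((m + 2 : ℕ) : ℤ) : Set ℤ) := hg.mono <| by
      exact_mod_cast (siteNeighbors_mono (siteNeighbors_Icc_subset m)).trans
        (siteNeighbors_Icc_subset (m + 1))
    -- `2 * m + 3` counts the sites of `[-(m+1), m+1]`, from which an attempt can affect `f`.
    have hgM : ∀ ξ, |jumpGenerator attempt p q f ξ| ≤ (2 * m + 3) * (2 * M) := fun ξ => by
      refine (abs_jumpGenerator_le hl hf hp hq hpq hM (siteNeighbors_Icc_subset m) ξ).trans_eq ?_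
      rw [Int.card_Icc]
      congr 1
      rw [show (((m + 1 : ℕ) : ℤ) + 1 - -((m + 1 : ℕ) : ℤ)).toNat = 2 * m + 3 by omega]
      push_cast
      ring
    rw [h₁.meanAt_eq_add hl hf ha (by linarith : a ≤ a + s),
      h₂.meanAt_eq_add hl hf ha (by linarith : a ≤ a + s), hD f _ hf, add_sub_add_left_eq_sub]
    have i₁ := h₁.intervalIntegrable_meanAt hg a (a + s)
    have i₂ := h₂.intervalIntegrable_meanAt hg a (a + s)
    rw [← intervalIntegral.integral_sub i₁ i₂]
    refine (intervalIntegral.abs_integral_le_integral_abs (by linarith)).trans ?_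
    refine (integral_le_of_le_pow (n := n)
      (C := 2 * ((2 * m + 3) * (2 * M)) * (generatorPowBound n (m + 2) / n.factorial)) hs
      (i₁.sub i₂).abs fun r hr => ?_).trans_eq ?_
    · have := ih (m + 2) _ _ hg' hgM (r - a) (by linarith [hr.1])
      simpa using this
    · rw [generatorPowBound_succ, Nat.factorial_succ]
      push_cast
      field_simp

lemma meanAt_eq_of_le (h₁ : IsJumpProcess attempt p q P₁ ξ₁ ξ₀)
    (h₂ : IsJumpProcess attempt p q P₂ ξ₂ ξ₀) (hl : IsLocalRule attempt)
    (hp : 0 ≤ p) (hq : 0 ≤ q) (hpq : p + q = 1) {a : ℝ} (ha : 0 ≤ a)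
    (hD : ∀ (f : (ℤ → A) → ℝ) (F : Finset ℤ), DependsOn f (F : Set ℤ) →
      meanAt P₁ ξ₁ f a = meanAt P₂ ξ₂ f a) {s : ℝ} (hs : 0 ≤ s) (hs' : s ≤ 1 / 16)
    {f : (ℤ → A) → ℝ} {F : Finset ℤ} (hf : DependsOn f (F : Set ℤ)) :
    meanAt P₁ ξ₁ f (a + s) = meanAt P₂ ξ₂ f (a + s) := by
  rcases hs.eq_or_lt with rfl | hs
  · simpa using hD f F hf
  obtain ⟨m, hm⟩ := exists_subset_Icc_neg F
  obtain ⟨M, -, hM⟩ := hf.exists_bound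
  have hf' : DependsOn f (Finset.Icc (-(m : ℤ)) m : Set ℤ) := hf.mono (by exact_mod_cast hm)
  have hlim := (tendsto_generatorPowBound m hs hs').const_mul (2 * M)
  rw [mul_zero] at hlim
  have := ge_of_tendsto' hlim fun n =>
    (abs_meanAt_sub_le h₁ h₂ hl hp hq hpq ha hD n m f M hf' hM s hs.le).trans_eq
      (mul_assoc _ _ _)
  exact sub_eq_zero.1 (abs_nonpos_iff.1 this)

/-- Two solutions of the martingale problem with the same initial configuration have the same
one-dimensional marginals. -/
theorem IsJumpProcess.meanAt_eq (h₁ : IsJumpProcess attempt p q P₁ ξ₁ ξ₀)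
    (h₂ : IsJumpProcess attempt p q P₂ ξ₂ ξ₀) (hl : IsLocalRule attempt)
    (hp : 0 ≤ p) (hq : 0 ≤ q) (hpq : p + q = 1) {t : ℝ} (ht : 0 ≤ t)
    {f : (ℤ → A) → ℝ} {F : Finset ℤ} (hf : DependsOn f (F : Set ℤ)) :
    meanAt P₁ ξ₁ f t = meanAt P₂ ξ₂ f t := by
  -- The admissible step `1 / 16` does not depend on `f` or on the starting time, so agreement for
  -- all local functions propagates along multiples of it.
  have key : ∀ (k : ℕ) (f : (ℤ → A) → ℝ) (F : Finset ℤ), DependsOn f (F : Set ℤ) →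
      meanAt P₁ ξ₁ f (k / 16) = meanAt P₂ ξ₂ f (k / 16) := by
    intro k
    induction k with
    | zero =>
      intro f F hf
      rw [Nat.cast_zero, zero_div, h₁.meanAt_eq_initial_add hl hf le_rfl,
        h₂.meanAt_eq_initial_add hl hf le_rfl]
      simp
    | succ k ih =>
      intro f F hf
      have := meanAt_eq_of_le h₁ h₂ hl hp hq hpq (by positivity) ih
        (by norm_num : (0 : ℝ) ≤ 1 / 16) le_rfl hf
      push_cast
      rwa [add_div]
  have h1 := Nat.floor_le (by positivity : 0 ≤ t * 16)
  have h2 := Nat.lt_floor_add_one (t * 16)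
  have := meanAt_eq_of_le h₁ h₂ hl hp hq hpq (by positivity) (key ⌊t * 16⌋₊)
    (s := t - ⌊t * 16⌋₊ / 16) (by linarith) (by linarith) hf
  simpa using this

end Uniqueness

/-! ### Functions that vanish along the process -/

section Vanishing

variable {A : Type*} [Finite A] [TopologicalSpace A] [DiscreteTopology A] [MeasurableSpace A]
  [MeasurableSingletonClass A] {attempt : ℤ → ℤ → (ℤ → A) → (ℤ → A)} {p q : ℝ}
  {Ω : Type*} [MeasurableSpace Ω] {P : Measure Ω} [IsProbabilityMeasure P]
  {ξ : ℝ≥0 → Ω → (ℤ → A)} {ξ₀ : ℤ → A}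

/-- If an attempt increases each member of a family of functions by at most another member of the
family, and all of them vanish initially, then they vanish at all later times. -/
theorem IsJumpProcess.ae_eq_zero (h : IsJumpProcess attempt p q P ξ ξ₀)
    (hl : IsLocalRule attempt) (hp : 0 ≤ p) (hq : 0 ≤ q) (hpq : p + q = 1)
    {ι : Type*} (f : ι → (ℤ → A) → ℝ) (F : ι → Finset ℤ) (r : ℕ) (ν : ℤ → ℤ → ι → ι)
    (hf : ∀ i, DependsOn (f i) (F i : Set ℤ)) (hr : ∀ i, (F i).card ≤ r)
    (h0 : ∀ i η, 0 ≤ f i η) (h1 : ∀ i η, f i η ≤ 1) (hinit : ∀ i, f i ξ₀ = 0)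
    (hν : ∀ i x y η, f i (attempt x y η) ≤ f i η + f (ν x y i) η) (i : ι) (t : ℝ≥0) :
    ∀ᵐ ω ∂P, f i (ξ t ω) = 0 := by
  -- Gronwall iteration over the whole family at once. At most `3 * r` sites matter for every
  -- member, so the constant does not grow with `n` and the bound tends to zero for every time.
  have hbound : ∀ (n : ℕ) (i : ι) (s : ℝ), 0 ≤ s →
      meanAt P ξ (f i) s ≤ (3 * r : ℝ) ^ n / n.factorial * s ^ n := by
    intro n
    induction n with
    | zero =>
      intro i s _
      simpa using (le_abs_self _).trans (abs_meanAt_le (P := P) (ξ := ξ)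
        (fun η => abs_le.2 ⟨by linarith [h0 i η], h1 i η⟩) s)
    | succ n ih =>
      intro i s hs
      have hg := dependsOn_jumpGenerator (p := p) (q := q) hl (hf i)
      have key := integral_le_of_le_pow (a := 0) (n := n)
        (C := 3 * r * ((3 * r : ℝ) ^ n / n.factorial)) hs
        (h.intervalIntegrable_meanAt hg 0 (0 + s)) fun u hu => ?_
      · rw [h.meanAt_eq_initial_add hl (hf i) hs, hinit, zero_add]
        rw [zero_add] at key
        refine key.trans_eq ?_
        rw [Nat.factorial_succ]
        push_cast
        field_simp
        ring
      · have hle : meanAt P ξ (jumpGenerator attempt p q (f i)) u ≤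
            ∑ x ∈ siteNeighbors (F i), (p * meanAt P ξ (f (ν x (x + 1) i)) u +
              q * meanAt P ξ (f (ν x (x - 1) i)) u) := by
          have hi : ∀ j k, Integrable (fun ω => p * f j (ξ u.toNNReal ω) +
              q * f k (ξ u.toNNReal ω)) P := fun j k =>
            ((h.integrable_comp (hf j) _).const_mul p).add
              ((h.integrable_comp (hf k) _).const_mul q)
          have he : ∀ j k, p * meanAt P ξ (f j) u + q * meanAt P ξ (f k) u =
              ∫ ω, (p * f j (ξ u.toNNReal ω) + q * f k (ξ u.toNNReal ω)) ∂P := fun j k => by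
            rw [integral_add ((h.integrable_comp (hf j) _).const_mul p)
              ((h.integrable_comp (hf k) _).const_mul q), integral_const_mul, integral_const_mul]
            rfl
          simp_rw [he]
          rw [← integral_finsetSum _ fun x _ => hi _ _]
          refine integral_mono (h.integrable_comp hg _)
            (integrable_finsetSum _ fun x _ => hi _ _) fun ω => ?_
          simp only
          rw [jumpGenerator_eq_sum hl (hf i) subset_rfl]
          refine Finset.sum_le_sum fun x _ => ?_
          gcongr
          · linarith [hν i x (x + 1) (ξ u.toNNReal ω)]
          · linarith [hν i x (x - 1) (ξ u.toNNReal ω)]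
        rw [sub_zero]
        have hu0 : 0 ≤ u := hu.1
        set B := (3 * r : ℝ) ^ n / n.factorial * u ^ n with hB
        have hB0 : 0 ≤ B := by positivity
        refine hle.trans ((Finset.sum_le_card_nsmul _ _ B fun x _ => ?_).trans ?_)
        · have e1 := mul_le_mul_of_nonneg_left (ih (ν x (x + 1) i) u hu0) hp
          have e2 := mul_le_mul_of_nonneg_left (ih (ν x (x - 1) i) u hu0) hq
          calc _ ≤ p * B + q * B := add_le_add e1 e2
            _ = B := by rw [← add_mul, hpq, one_mul]
        · rw [nsmul_eq_mul, mul_assoc (3 * (r : ℝ))]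
          have : ((siteNeighbors (F i)).card : ℝ) ≤ 3 * r := by
            exact_mod_cast (card_siteNeighbors_le _).trans (Nat.mul_le_mul_left 3 (hr i))
          exact mul_le_mul_of_nonneg_right this hB0
  have hlim := FloorSemiring.tendsto_pow_div_factorial_atTop (3 * r * (t : ℝ))
  have hle : meanAt P ξ (f i) t ≤ 0 := ge_of_tendsto' hlim fun n =>
    (hbound n i t t.coe_nonneg).trans_eq (by rw [mul_pow]; ring)
  have heq : ∫ ω, f i (ξ t ω) ∂P = 0 := by
    simp only [meanAt, Real.toNNReal_coe] at hle
    exact le_antisymm hle (integral_nonneg fun ω => h0 i _)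
  exact (integral_eq_zero_iff_of_nonneg (fun ω => h0 i _) (h.integrable_comp (hf i) t)).1 heq

end Vanishing

/-! ### Images of jump processes under maps of the local states -/

section Map

variable {A B : Type*} [Finite A] [TopologicalSpace A] [DiscreteTopology A] [MeasurableSpace A]
  [MeasurableSingletonClass A] [Finite B] [TopologicalSpace B] [DiscreteTopology B]
  [MeasurableSpace B] [MeasurableSingletonClass B]
  {a : ℤ → ℤ → (ℤ → A) → (ℤ → A)} {b : ℤ → ℤ → (ℤ → B) → (ℤ → B)} {p q : ℝ}
  {Ω : Type*} [MeasurableSpace Ω] {P : Measure Ω}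
  {ξ : ℝ≥0 → Ω → (ℤ → A)} {ξ₀ : ℤ → A}

/-- If a map of the local states intertwines two rules along almost every path, it maps a jump
process for the first rule to one for the second. -/
theorem IsJumpProcess.map (h : IsJumpProcess a p q P ξ ξ₀) (hb : IsLocalRule b) (π : A → B)
    (hπ : ∀ᵐ ω ∂P, ∀ t x y, π ∘ a x y (ξ t ω) = b x y (π ∘ ξ t ω)) :
    IsJumpProcess b p q P (fun t ω => π ∘ ξ t ω) (π ∘ ξ₀) := by
  have hcont : Continuous fun σ : ℤ → A => π ∘ σ :=
    continuous_pi fun z => continuous_of_discreteTopology.comp (continuous_apply z)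
  have hmeas : Measurable fun σ : ℤ → A => π ∘ σ :=
    measurable_pi_lambda _ fun z => (measurable_of_finite π).comp (measurable_pi_apply z)
  have hrc : ∀ ω t, ContinuousWithinAt (fun s => π ∘ ξ s ω) (Set.Ici t) t := fun ω t =>
    hcont.continuousAt.comp_continuousWithinAt (h.right_continuous ω t)
  refine ⟨hrc, fun ω t => ?_, h.initial.mono fun ω hω => congrArg (π ∘ ·) hω, ?_⟩
  · obtain ⟨l, hl⟩ := h.left_limits ω t
    exact ⟨_, (hcont.tendsto l).comp hl⟩
  obtain ⟨ℱ, hℱ, hM⟩ := h.martingale_problem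
  refine ⟨ℱ, fun t => hmeas.comp (hℱ t), fun f F hf => ?_⟩
  have hf' : DependsOn (fun σ : ℤ → A => f (π ∘ σ)) (F : Set ℤ) := fun σ σ' hσ =>
    hf fun i hi => congrArg π (hσ i hi)
  -- The intertwining holds only almost surely and the filtration need not contain null sets, so
  -- adaptedness is proved directly instead of being transferred.
  refine (hM _ F hf').congr (fun t => ?_) fun t => ?_
  · have hg := dependsOn_jumpGenerator (p := p) (q := q) hb hf
    refine StronglyMeasurable.sub
      (hf.measurable_of_finset.comp (hmeas.comp (hℱ t))).stronglyMeasurable ?_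
    exact @stronglyMeasurable_integral_path Ω (ℱ t)
      (fun s ω => jumpGenerator b p q f (π ∘ ξ s ω)) t
      (fun s hs => hg.measurable_of_finset.comp
        (hmeas.comp ((hℱ s).mono (ℱ.mono hs) le_rfl)))
      fun ω s => hg.continuous_of_finset.continuousAt.comp_continuousWithinAt (hrc ω s)
  · filter_upwards [hπ] with ω hω
    simp only [jumpGenerator, hω]

end Map

/-! ### The three rules -/

lemma isLocalRule_swap {A : Type*} (C : A → A → Prop) [DecidableRel C] :
    IsLocalRule fun (x y : ℤ) (ξ : ℤ → A) => if C (ξ x) (ξ y) then ξ ∘ Equiv.swap x y else ξ where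
  apply_of_ne {x y z} ξ hx hy := by
    split_ifs <;> simp [Equiv.swap_apply_of_ne_of_ne hx hy]
  apply_congr {x y z ξ ξ'} hx hy hz := by
    rw [hx, hy]
    split_ifs
    · simp only [Function.comp_apply, Equiv.swap_apply_def]
      split_ifs <;> assumption
    · exact hz

lemma isLocalRule_exclusionAttempt : IsLocalRule exclusionAttempt :=
  isLocalRule_swap fun a b : Bool => a = true ∧ b = false

lemma isLocalRule_twoClassAttempt : IsLocalRule twoClassAttempt :=
  isLocalRule_swap fun a b : SiteState => a.rank < b.rank

lemma isLocalRule_basicCouplingAttempt : IsLocalRule basicCouplingAttempt where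
  apply_of_ne ξ hx hy := Prod.ext
    (isLocalRule_exclusionAttempt.apply_of_ne (fun w => (ξ w).1) hx hy)
    (isLocalRule_exclusionAttempt.apply_of_ne (fun w => (ξ w).2) hx hy)
  apply_congr {_ _ _ ξ ξ'} hx hy hz := Prod.ext
    (isLocalRule_exclusionAttempt.apply_congr (ξ := fun w => (ξ w).1) (ξ' := fun w => (ξ' w).1)
      (congrArg Prod.fst hx) (congrArg Prod.fst hy) (congrArg Prod.fst hz))
    (isLocalRule_exclusionAttempt.apply_congr (ξ := fun w => (ξ w).2) (ξ' := fun w => (ξ' w).2)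
      (congrArg Prod.snd hx) (congrArg Prod.snd hy) (congrArg Prod.snd hz))

/-- The local state of the two-class process that corresponds to a local state of the coupling. -/
def classifySite (s : Bool × Bool) : SiteState :=
  if s.1 = true then .first else if s.2 = true then .second else .hole

/-- The local state of the coupling that corresponds to a local state of the two-class process. -/
def coupleSite (s : SiteState) : Bool × Bool := (decide (s = .first), decide (s ≠ .hole))

instance : Finite SiteState :=
  Finite.of_injective coupleSite fun a b h => by cases a <;> cases b <;> simp_all [coupleSite]

lemma exclusionAttempt_apply (x y z : ℤ) (η : Config) :
    exclusionAttempt x y η z =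
      if η x = true ∧ η y = false then η (Equiv.swap x y z) else η z := by
  unfold exclusionAttempt
  split_ifs <;> rfl

lemma twoClassAttempt_apply (x y z : ℤ) (ξ : ℤ → SiteState) :
    twoClassAttempt x y ξ z =
      if (ξ x).rank < (ξ y).rank then ξ (Equiv.swap x y z) else ξ z := by
  unfold twoClassAttempt
  split_ifs <;> rfl

lemma basicCouplingAttempt_apply (x y z : ℤ) (σ : ℤ → Bool × Bool) :
    basicCouplingAttempt x y σ z =
      (if (σ x).1 = true ∧ (σ y).1 = false then (σ (Equiv.swap x y z)).1 else (σ z).1,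
        if (σ x).2 = true ∧ (σ y).2 = false then (σ (Equiv.swap x y z)).2 else (σ z).2) :=
  Prod.ext (exclusionAttempt_apply x y z fun w => (σ w).1)
    (exclusionAttempt_apply x y z fun w => (σ w).2)

/-- The basic coupling is attractive: an attempt creates a particle of `η` at a site that is empty
in `ζ` only by moving one. -/
lemma basicCouplingAttempt_eq_true_false {x y z : ℤ} {σ : ℤ → Bool × Bool}
    (h : basicCouplingAttempt x y σ z = (true, false)) :
    σ z = (true, false) ∨ σ (Equiv.swap x y z) = (true, false) := by
  rw [basicCouplingAttempt_apply] at h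
  rw [Equiv.swap_apply_def] at h ⊢
  split_ifs at h ⊢ <;> subst_vars <;> simp_all [Prod.ext_iff]

/-- A finite check on the states at `x` and `y`. Order is essential: an attempt from `(true, false)`
onto `(false, true)` would make the discrepancies cancel, leaving a hole where the two-class rule
leaves a second class particle. -/
lemma classifySite_comp_basicCouplingAttempt {σ : ℤ → Bool × Bool}
    (hσ : ∀ z, σ z ≠ (true, false)) (x y : ℤ) :
    classifySite ∘ basicCouplingAttempt x y σ = twoClassAttempt x y (classifySite ∘ σ) := by
  funext z
  rw [Function.comp_apply, twoClassAttempt_apply, basicCouplingAttempt_apply]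
  simp only [Function.comp_apply]
  rcases eq_or_ne z x with rfl | hzx
  · rw [Equiv.swap_apply_left]
    generalize hu : σ z = u, hv : σ y = v
    have hu' := hu ▸ hσ z
    have hv' := hv ▸ hσ y
    revert hu' hv'
    clear hu hv
    revert u v
    decide
  rcases eq_or_ne z y with rfl | hzy
  · rw [Equiv.swap_apply_right]
    generalize hu : σ x = u, hv : σ z = v
    have hu' := hu ▸ hσ x
    have hv' := hv ▸ hσ z
    revert hu' hv'
    clear hu hv
    revert u v
    decide
  · simp [Equiv.swap_apply_of_ne_of_ne hzx hzy]

/-- No restriction on `ξ` is needed, as `coupleSite` never takes the value `(true, false)`. -/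
lemma coupleSite_comp_twoClassAttempt (x y : ℤ) (ξ : ℤ → SiteState) :
    coupleSite ∘ twoClassAttempt x y ξ = basicCouplingAttempt x y (coupleSite ∘ ξ) := by
  funext z
  rw [Function.comp_apply, twoClassAttempt_apply, basicCouplingAttempt_apply]
  simp only [Function.comp_apply]
  rcases eq_or_ne z x with rfl | hzx
  · rw [Equiv.swap_apply_left]
    generalize ξ z = u, ξ y = v
    cases u <;> cases v <;> rfl
  rcases eq_or_ne z y with rfl | hzy
  · rw [Equiv.swap_apply_right]
    generalize ξ x = u, ξ z = v
    cases u <;> cases v <;> rfl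
  · simp [Equiv.swap_apply_of_ne_of_ne hzx hzy]

/-! ### There is at most one second class particle -/

section SecondClass

variable {p q : ℝ} {Ω : Type*} [MeasurableSpace Ω] {P : Measure Ω} [IsProbabilityMeasure P]
  {ξ : ℝ≥0 → Ω → (ℤ → SiteState)} {Y : Set ℤ}

lemma secondClassAtOrigin_eq_second {x : ℤ} (h : secondClassAtOrigin Y x = .second) : x = 0 := by
  unfold secondClassAtOrigin at h
  split_ifs at h with h1 h2
  exact h2

lemma secondClassAtOrigin_zero (hY : (0 : ℤ) ∉ Y) : secondClassAtOrigin Y 0 = .second := by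
  simp [secondClassAtOrigin, hY]

/-- At two distinct sites there are never second class particles simultaneously. -/
theorem IsSecondClassASEP.ae_unique (h : IsSecondClassASEP p q P ξ Y) (hp : 0 ≤ p) (hq : 0 ≤ q)
    (hpq : p + q = 1) :
    ∀ᵐ ω ∂P, ∀ t x y, ξ t ω x = .second → ξ t ω y = .second → x = y := by
  let f : {z : ℤ × ℤ // z.1 ≠ z.2} → (ℤ → SiteState) → ℝ := fun z η =>
    if η z.1.1 = .second ∧ η z.1.2 = .second then 1 else 0
  have hdep : ∀ z, DependsOn (f z) (({z.1.1, z.1.2} : Finset ℤ) : Set ℤ) := by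
    intro z η η' hη
    simp only [f]
    rw [hη z.1.1 (by simp), hη z.1.2 (by simp)]
  have h0 : ∀ z η, 0 ≤ f z η := fun z η => by
    simp only [f]
    split_ifs <;> norm_num
  have key : ∀ z, ∀ᵐ ω ∂P, ∀ t, f z (ξ t ω) = 0 := fun z =>
    h.ae_forall_eq_zero (hdep z) fun t =>
      h.ae_eq_zero isLocalRule_twoClassAttempt hp hq hpq f (fun z => {z.1.1, z.1.2}) 2
        -- An exchange carries the indicator of a pair to that of the swapped pair, whose sites are
        -- again distinct.
        (fun a b z => ⟨(Equiv.swap a b z.1.1, Equiv.swap a b z.1.2), fun he =>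
          z.2 ((Equiv.swap a b).injective he)⟩)
        hdep (fun z => Finset.card_le_two) h0
        (fun z η => by
          simp only [f]
          split_ifs <;> norm_num)
        (fun z => if_neg fun hz => z.2 ((secondClassAtOrigin_eq_second hz.1).trans
          (secondClassAtOrigin_eq_second hz.2).symm))
        (fun z a b η => by
          by_cases hr : (η a).rank < (η b).rank
          · rw [twoClassAttempt, if_pos hr]
            exact le_add_of_nonneg_left (h0 z η)
          · rw [twoClassAttempt, if_neg hr]
            exact le_add_of_nonneg_right (h0 _ η)) z t
  filter_upwards [ae_all_iff.2 key] with ω hω t x y hx hy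
  by_contra hxy
  simpa [f, hx, hy] using hω ⟨(x, y), hxy⟩ t

/-! ### The second class particle does not escape -/

/-- The tent function of height one and slope `1 / n`. -/
noncomputable def tent (n : ℕ) (x : ℤ) : ℝ := max 0 (1 - |(x : ℝ)| / n)

lemma tent_le_one (n : ℕ) (x : ℤ) : tent n x ≤ 1 :=
  max_le zero_le_one (sub_le_self _ (by positivity))

lemma tent_zero (n : ℕ) : tent n 0 = 1 := by simp [tent]

lemma abs_tent_sub_le (n : ℕ) {x y : ℤ} (h : |x - y| ≤ 1) : |tent n x - tent n y| ≤ 1 / n := by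
  refine (abs_max_sub_max_le_max _ _ _ _).trans ?_
  have h' : |(x : ℝ) - y| ≤ 1 := by exact_mod_cast h
  rw [sub_self, abs_zero, sub_sub_sub_cancel_left, ← sub_div, abs_div, Nat.abs_cast]
  refine max_le (by positivity) ?_
  gcongr
  rw [abs_sub_comm] at h'
  exact (abs_abs_sub_abs_le _ _).trans h'

lemma tent_eq_zero {n : ℕ} (hn : n ≠ 0) {x : ℤ} (hx : x ∉ Finset.Icc (-(n : ℤ)) n) :
    tent n x = 0 := by
  refine max_eq_left ?_
  have h1 : (n : ℤ) ≤ |x| := by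
    rw [Finset.mem_Icc, ← abs_le, not_le] at hx
    exact hx.le
  have h2 : (n : ℝ) ≤ |(x : ℝ)| := by exact_mod_cast h1
  have h3 : (0 : ℝ) < n := by positivity
  rw [sub_nonpos, one_le_div h3]
  exact h2

/-- The sum of the tent function over the second class particles. -/
noncomputable def tentSum (n : ℕ) (η : ℤ → SiteState) : ℝ :=
  ∑ x ∈ Finset.Icc (-(n : ℤ)) n, if η x = .second then tent n x else 0

lemma dependsOn_tentSum (n : ℕ) : DependsOn (tentSum n) (Finset.Icc (-(n : ℤ)) n : Set ℤ) :=
  fun _ _ h => Finset.sum_congr rfl fun x hx => by rw [h x (by exact_mod_cast hx)]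

/-- The tent vanishes outside the summation range, so a function of finitely many sites reads off
the position of a single particle. -/
lemma tentSum_eq_tent {n : ℕ} (hn : n ≠ 0) {η : ℤ → SiteState} {c : ℤ}
    (h : ∀ x, η x = .second ↔ x = c) : tentSum n η = tent n c := by
  simp only [tentSum, h]
  rw [Finset.sum_ite_eq']
  split_ifs with hc
  · rfl
  · exact (tent_eq_zero hn hc).symm

lemma tentSum_eq_zero (n : ℕ) {η : ℤ → SiteState} (h : ∀ x, η x ≠ .second) : tentSum n η = 0 := by
  simp [tentSum, h]

lemma tentSum_le_one {n : ℕ} (hn : n ≠ 0) {η : ℤ → SiteState}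
    (h : ∀ x y, η x = .second → η y = .second → x = y) : tentSum n η ≤ 1 := by
  by_cases he : ∃ c, η c = .second
  · obtain ⟨c, hc⟩ := he
    rw [tentSum_eq_tent hn fun x => ⟨fun hx => h x c hx hc, fun hx => hx ▸ hc⟩]
    exact tent_le_one n c
  · rw [tentSum_eq_zero n (not_exists.1 he)]
    exact zero_le_one

lemma abs_tentSum_twoClassAttempt_sub_le {n : ℕ} (hn : n ≠ 0) {η : ℤ → SiteState} {c x y : ℤ}
    (h : ∀ x, η x = .second ↔ x = c) (hxy : |x - y| ≤ 1) :
    |tentSum n (twoClassAttempt x y η) - tentSum n η| ≤ 1 / n := by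
  unfold twoClassAttempt
  split_ifs
  · rw [tentSum_eq_tent hn h, tentSum_eq_tent hn (c := Equiv.swap x y c) fun z => by
      rw [Function.comp_apply, h, Equiv.swap_apply_eq_iff]]
    refine abs_tent_sub_le n ?_
    rw [Equiv.swap_apply_def]
    split_ifs with h1 h2
    · rwa [h1, abs_sub_comm]
    · rwa [h2]
    · simp
  · simp

lemma tentSum_twoClassAttempt_of_ne {n : ℕ} (hn : n ≠ 0) {η : ℤ → SiteState} {c x y : ℤ}
    (h : ∀ x, η x = .second ↔ x = c) (hx : c ≠ x) (hy : c ≠ y) :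
    tentSum n (twoClassAttempt x y η) = tentSum n η := by
  unfold twoClassAttempt
  split_ifs
  · rw [tentSum_eq_tent hn h, tentSum_eq_tent hn (c := c) fun z => by
      rw [Function.comp_apply, h, Equiv.swap_apply_eq_iff, Equiv.swap_apply_of_ne_of_ne hx hy]]
  · rfl

/-- Only attempts from `c - 1`, `c`, `c + 1` can move a particle at `c`; each site has total rate
one and changes the tent by at most `1 / n`. -/
lemma abs_jumpGenerator_tentSum_le (hp : 0 ≤ p) (hq : 0 ≤ q) (hpq : p + q = 1) {n : ℕ}
    (hn : n ≠ 0) {η : ℤ → SiteState} (h : ∀ x y, η x = .second → η y = .second → x = y) :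
    |jumpGenerator twoClassAttempt p q (tentSum n) η| ≤ 3 / n := by
  by_cases he : ∃ c, η c = .second
  · obtain ⟨c, hc⟩ := he
    have h' : ∀ x, η x = .second ↔ x = c := fun x => ⟨fun hx => h x c hx hc, fun hx => hx ▸ hc⟩
    have hsum : jumpGenerator twoClassAttempt p q (tentSum n) η =
        ∑ x ∈ ({c - 1, c, c + 1} : Finset ℤ),
          (p * (tentSum n (twoClassAttempt x (x + 1) η) - tentSum n η) +
            q * (tentSum n (twoClassAttempt x (x - 1) η) - tentSum n η)) := by
      refine tsum_eq_sum fun x hx => ?_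
      simp only [Finset.mem_insert, Finset.mem_singleton, not_or] at hx
      rw [tentSum_twoClassAttempt_of_ne hn h' (by omega) (by omega),
        tentSum_twoClassAttempt_of_ne hn h' (by omega) (by omega)]
      simp
    rw [hsum]
    have hb : ∀ x, |p * (tentSum n (twoClassAttempt x (x + 1) η) - tentSum n η) +
        q * (tentSum n (twoClassAttempt x (x - 1) η) - tentSum n η)| ≤ 1 / n := fun x => by
      have h1 := abs_tentSum_twoClassAttempt_sub_le hn h' (x := x) (y := x + 1) (by simp)
      have h2 := abs_tentSum_twoClassAttempt_sub_le hn h' (x := x) (y := x - 1) (by simp)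
      calc _ ≤ p * |tentSum n (twoClassAttempt x (x + 1) η) - tentSum n η| +
            q * |tentSum n (twoClassAttempt x (x - 1) η) - tentSum n η| := by
            refine (abs_add_le _ _).trans_eq ?_
            rw [abs_mul, abs_mul, abs_of_nonneg hp, abs_of_nonneg hq]
        _ ≤ p * (1 / n) + q * (1 / n) := by gcongr
        _ = 1 / n := by rw [← add_mul, hpq, one_mul]
    refine (Finset.abs_sum_le_sum_abs _ _).trans
      ((Finset.sum_le_card_nsmul _ _ _ fun x _ => hb x).trans ?_)
    rw [nsmul_eq_mul, mul_one_div]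
    gcongr
    exact_mod_cast Finset.card_le_three
  · have h0 := not_exists.1 he
    have h1 : ∀ x y, tentSum n (twoClassAttempt x y η) = 0 := fun x y =>
      tentSum_eq_zero n fun z => by
        rw [twoClassAttempt_apply]
        split_ifs
        exacts [h0 _, h0 _]
    simp only [jumpGenerator, h1, tentSum_eq_zero n h0, sub_zero, mul_zero, add_zero, tsum_zero,
      abs_zero]
    positivity

end SecondClass

/-! ### A maximal inequality -/

/-- A maximal inequality along an increasing sequence of times, for a process that is almost surely
dominated by a martingale with nonnegative terminal value. -/
lemma measure_exists_le_of_martingale {Ω : Type*} [MeasurableSpace Ω] {P : Measure Ω}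
    [IsProbabilityMeasure P] {ℱ : Filtration ℝ≥0 (inferInstance : MeasurableSpace Ω)}
    {V : ℝ≥0 → Ω → ℝ} (hV : Martingale V ℱ P) {τ : ℕ → ℝ≥0} (hτ : Monotone τ) (N : ℕ)
    {H : ℝ≥0 → Ω → ℝ} (hH : ∀ᵐ ω ∂P, ∀ j ≤ N, H (τ j) ω ≤ V (τ j) ω)
    (h0 : ∀ᵐ ω ∂P, 0 ≤ V (τ N) ω) {ε : ℝ≥0} :
    ε * P {ω | ∃ j ≤ N, (ε : ℝ) ≤ H (τ j) ω} ≤ ENNReal.ofReal (∫ ω, V 0 ω ∂P) := by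
  let 𝒢 : Filtration ℕ (inferInstance : MeasurableSpace Ω) :=
    ⟨fun j => ℱ (τ j), fun i j hij => ℱ.mono (hτ hij), fun j => ℱ.le _⟩
  have hm : Martingale (fun j => V (τ j)) 𝒢 P :=
    ⟨fun j => hV.1 (τ j), fun i j hij => hV.2 _ _ (hτ hij)⟩
  -- `V` is known to be nonnegative only at the terminal time; the positive part gives a nonnegative
  -- submartingale with the same terminal mean.
  have hsub := hm.submartingale.pos
  have hmax := maximal_ineq hsub (fun j ω => posPart_nonneg _) (ε := ε) N
  have hEq : ∫ ω, V (τ N) ω ∂P = ∫ ω, V 0 ω ∂P := by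
    simpa using (hV.setIntegral_eq (zero_le : 0 ≤ τ N) MeasurableSet.univ).symm
  refine le_trans ?_ (hmax.trans (ENNReal.ofReal_le_ofReal ?_))
  · refine mul_le_mul' le_rfl (measure_mono_ae ?_)
    filter_upwards [hH] with ω hω hj
    obtain ⟨j, hj, hle⟩ := hj
    refine (Finset.le_sup'_iff _).2 ⟨j, Finset.mem_range.2 (by omega), ?_⟩
    exact (hle.trans (hω j hj)).trans (le_posPart _)
  · rw [← hEq]
    refine (setIntegral_le_integral (hsub.integrable N)
      (Eventually.of_forall fun ω => posPart_nonneg _)).trans_eq (integral_congr_ae ?_)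
    filter_upwards [h0] with ω hω
    exact posPart_of_nonneg hω

/-! ### Survival of the second class particle. -/

section Survival

variable {p q : ℝ} {Ω : Type*} [MeasurableSpace Ω] {P : Measure Ω} [IsProbabilityMeasure P]
  {ξ : ℝ≥0 → Ω → (ℤ → SiteState)} {Y : Set ℤ}

lemma IsSecondClassASEP.measure_tentSum_le (h : IsSecondClassASEP p q P ξ Y) (hY : (0 : ℤ) ∉ Y)
    (hp : 0 ≤ p) (hq : 0 ≤ q) (hpq : p + q = 1) {n : ℕ} (hn : n ≠ 0) (T k : ℕ) :
    P {ω | ∃ j ≤ T * 2 ^ k, 1 / 2 ≤ 1 - tentSum n (ξ (j / 2 ^ k) ω)} ≤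
      2 * ENNReal.ofReal (3 / n * T) := by
  obtain ⟨ℱ, -, hM⟩ := h.martingale_problem
  -- The shift `3 / n * T` absorbs the drift up to time `T`, so this martingale dominates `1 -
  -- tentSum`; its initial mean is only `3 / n * T`, as the tent is one at the origin.
  have hV := (martingale_const ℱ P (1 + 3 / n * (T : ℝ))).sub
    (hM (tentSum n) _ (dependsOn_tentSum n))
  have huniq := h.ae_unique hp hq hpq
  have hint : ∀ᵐ ω ∂P, ∀ t : ℝ≥0, t ≤ T →
      |∫ s in (0 : ℝ)..t, jumpGenerator twoClassAttempt p q (tentSum n) (ξ s.toNNReal ω)| ≤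
        3 / n * T := by
    filter_upwards [huniq] with ω hω t ht
    refine (intervalIntegral.norm_integral_le_of_norm_le_const (C := 3 / n)
      (f := fun s => jumpGenerator twoClassAttempt p q (tentSum n) (ξ s.toNNReal ω))
      fun s _ => abs_jumpGenerator_tentSum_le hp hq hpq hn (hω s.toNNReal)).trans ?_
    rw [sub_zero, abs_of_nonneg t.coe_nonneg]
    gcongr
    exact_mod_cast ht
  have hτ : Monotone fun j : ℕ => (j : ℝ≥0) / 2 ^ k := fun i j hij => by
    simp only
    gcongr
  have hT : ∀ j ≤ T * 2 ^ k, (j : ℝ≥0) / 2 ^ k ≤ T := fun j hj => by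
    rw [div_le_iff₀ (by positivity)]
    exact_mod_cast hj
  have hH : ∀ᵐ ω ∂P, ∀ j ≤ T * 2 ^ k, 1 - tentSum n (ξ ((j : ℝ≥0) / 2 ^ k) ω) ≤
      1 + 3 / n * (T : ℝ) - (tentSum n (ξ ((j : ℝ≥0) / 2 ^ k) ω) -
        ∫ s in (0 : ℝ)..((j : ℝ≥0) / 2 ^ k : ℝ≥0),
          jumpGenerator twoClassAttempt p q (tentSum n) (ξ s.toNNReal ω)) := by
    filter_upwards [hint] with ω hω j hj
    linarith [(abs_le.1 (hω _ (hT j hj))).1]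
  have hnonneg := huniq.mono fun ω hω =>
    sub_nonneg.2 (tentSum_le_one hn (hω (((T * 2 ^ k : ℕ) : ℝ≥0) / 2 ^ k)))
  have key := measure_exists_le_of_martingale hV hτ (T * 2 ^ k)
    (H := fun t ω => 1 - tentSum n (ξ t ω)) (ε := 1 / 2) hH
    (hH.and hnonneg |>.mono fun ω hω => hω.2.trans (hω.1 _ le_rfl))
  have h0 : ∫ ω, (1 + 3 / n * (T : ℝ) - (tentSum n (ξ 0 ω) -
      ∫ s in (0 : ℝ)..(0 : ℝ≥0),
        jumpGenerator twoClassAttempt p q (tentSum n) (ξ s.toNNReal ω))) ∂P = 3 / n * T := by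
    have : ∀ᵐ ω ∂P, 1 + 3 / n * (T : ℝ) - (tentSum n (ξ 0 ω) -
        ∫ s in (0 : ℝ)..(0 : ℝ≥0),
          jumpGenerator twoClassAttempt p q (tentSum n) (ξ s.toNNReal ω)) = 3 / n * T := by
      filter_upwards [h.initial] with ω hω
      rw [hω, tentSum_eq_tent hn (c := 0) fun x => ⟨secondClassAtOrigin_eq_second,
        fun hx => hx ▸ secondClassAtOrigin_zero hY⟩, tent_zero]
      simp
    rw [integral_congr_ae this]
    simp
  have key' : ((1 / 2 : ℝ≥0) : ENNReal) *
      P {ω | ∃ j ≤ T * 2 ^ k, 1 / 2 ≤ 1 - tentSum n (ξ (j / 2 ^ k) ω)} ≤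
      ENNReal.ofReal (3 / n * T) := by
    rw [← h0]
    simpa using key
  calc _ = 2 * (((1 / 2 : ℝ≥0) : ENNReal) *
        P {ω | ∃ j ≤ T * 2 ^ k, 1 / 2 ≤ 1 - tentSum n (ξ (j / 2 ^ k) ω)}) := by
        rw [← mul_assoc, ← ENNReal.coe_ofNat, ← ENNReal.coe_mul]
        simp
    _ ≤ _ := by gcongr

lemma exists_dyadic_near {t δ : ℝ≥0} (hδ : 0 < δ) :
    ∃ k j : ℕ, t ≤ (j : ℝ≥0) / 2 ^ k ∧ (j : ℝ≥0) / 2 ^ k < t + δ := by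
  obtain ⟨k, hk⟩ := exists_pow_lt_of_lt_one hδ (by norm_num : (1 / 2 : ℝ≥0) < 1)
  refine ⟨k, ⌈t * 2 ^ k⌉₊, ?_, ?_⟩
  · rw [le_div_iff₀ (by positivity)]
    exact Nat.le_ceil _
  · rw [div_lt_iff₀ (by positivity), add_mul]
    refine (Nat.ceil_lt_add_one (by positivity)).trans_le ?_
    gcongr
    rw [one_div, inv_pow] at hk
    exact ((inv_lt_iff_one_lt_mul₀ (by positivity)).1 hk).le

/-- Almost surely there is a second class particle at all times. -/
theorem IsSecondClassASEP.ae_exists (h : IsSecondClassASEP p q P ξ Y) (hY : (0 : ℤ) ∉ Y)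
    (hp : 0 ≤ p) (hq : 0 ≤ q) (hpq : p + q = 1) :
    ∀ᵐ ω ∂P, ∀ t, ∃ x, ξ t ω x = .second := by
  let bad : ℕ → ℕ → ℕ → Set Ω := fun n T k =>
    {ω | ∃ j ≤ T * 2 ^ k, 1 / 2 ≤ 1 - tentSum (n + 1) (ξ (j / 2 ^ k) ω)}
  -- Dyadic grids are nested, so the bound, uniform in `k`, passes to the union over all dyadic
  -- times.
  have hmono : ∀ n T, Monotone (bad n T) := fun n T => monotone_nat_of_le_succ fun k ω hω => by
    obtain ⟨j, hj, hle⟩ := hω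
    refine ⟨j * 2, by rw [pow_succ]; nlinarith, ?_⟩
    rwa [Nat.cast_mul, pow_succ, Nat.cast_ofNat, mul_div_mul_right _ _ (by norm_num)]
  have hbound : ∀ n T, P (⋃ k, bad n T k) ≤ 2 * ENNReal.ofReal (3 / ((n + 1 : ℕ) : ℝ) * T) :=
    fun n T => by
      rw [(hmono n T).measure_iUnion]
      exact iSup_le fun k => h.measure_tentSum_le hY hp hq hpq n.succ_ne_zero T k
  have hnull : ∀ T, P (⋂ n, ⋃ k, bad n T k) = 0 := fun T => by
    have hlim : Tendsto (fun n : ℕ => 2 * ENNReal.ofReal (3 / ((n + 1 : ℕ) : ℝ) * T)) atTop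
        (𝓝 0) := by
      have h1 : Tendsto (fun n : ℕ => 3 / ((n + 1 : ℕ) : ℝ) * T) atTop (𝓝 0) := by
        simpa using ((tendsto_const_div_atTop_nhds_zero_nat (3 : ℝ)).comp
          (tendsto_add_atTop_nat 1)).mul_const (T : ℝ)
      simpa using ENNReal.Tendsto.const_mul (ENNReal.tendsto_ofReal h1)
        (Or.inr (by norm_num : (2 : ENNReal) ≠ ⊤))
    exact le_antisymm (ge_of_tendsto' hlim fun n =>
      (measure_mono (Set.iInter_subset _ n)).trans (hbound n T)) (zero_le)
  have hae : ∀ T : ℕ, ∀ᵐ ω ∂P, ω ∉ ⋂ n, ⋃ k, bad n T k := fun T =>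
    measure_eq_zero_iff_ae_notMem.1 (hnull T)
  filter_upwards [ae_all_iff.2 hae] with ω hω t
  by_contra hno
  obtain ⟨T, hT⟩ := exists_nat_gt t
  refine hω T (Set.mem_iInter.2 fun n => ?_)
  have hc := h.continuousWithinAt_comp (dependsOn_tentSum (n + 1)) ω t
  -- With no second class particle at `t`, every tent sum vanishes there and stays below `1 / 2`
  -- just after `t`. A dyadic time in that interval makes `ω` bad for every width, which is a null
  -- event.
  have hev : ∀ᶠ s in 𝓝[≥] t, tentSum (n + 1) (ξ s ω) < 1 / 2 := by
    refine hc.eventually_lt_const ?_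
    simp only [tentSum_eq_zero (n + 1) (not_exists.1 hno)]
    norm_num
  have hev' : ∀ᶠ s in 𝓝[≥] t, s < (T : ℝ≥0) :=
    eventually_nhdsWithin_of_eventually_nhds (eventually_lt_nhds hT)
  obtain ⟨u, htu, hu⟩ := mem_nhdsGE_iff_exists_Ico_subset.1 (hev.and hev')
  obtain ⟨k, j, h1, h2⟩ := exists_dyadic_near (t := t) (tsub_pos_of_lt htu)
  rw [add_tsub_cancel_of_le htu.le] at h2
  have h3 := hu ⟨h1, h2⟩
  refine Set.mem_iUnion.2 ⟨k, j, ?_, ?_⟩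
  · have := (div_lt_iff₀ (by positivity)).1 h3.2
    exact_mod_cast this.le
  · have := h3.1
    linarith

theorem IsSecondClassASEP.ae_existsUnique (h : IsSecondClassASEP p q P ξ Y) (hY : (0 : ℤ) ∉ Y)
    (hp : 0 ≤ p) (hq : 0 ≤ q) (hpq : p + q = 1) :
    ∀ᵐ ω ∂P, ∀ t, ∃! x : ℤ, ξ t ω x = .second := by
  filter_upwards [h.ae_exists hY hp hq hpq, h.ae_unique hp hq hpq] with ω h1 h2 t
  obtain ⟨x, hx⟩ := h1 t
  exact ⟨x, hx, fun y hy => h2 t y x hy hx⟩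

end Survival

/-! ### The basic coupling -/

section Coupling

variable {p q : ℝ} {Ω : Type*} [MeasurableSpace Ω] {P : Measure Ω}
  {η ζ : ℝ≥0 → Ω → Config} {Y Y' : Set ℤ}

lemma IsBasicCoupling.isASEP_fst (h : IsBasicCoupling p q P η ζ Y Y') : IsASEP p q P η Y :=
  IsJumpProcess.map h isLocalRule_exclusionAttempt Prod.fst
    (Eventually.of_forall fun _ _ _ _ => rfl)

lemma IsBasicCoupling.isASEP_snd (h : IsBasicCoupling p q P η ζ Y Y') : IsASEP p q P ζ Y' :=
  IsJumpProcess.map h isLocalRule_exclusionAttempt Prod.snd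
    (Eventually.of_forall fun _ _ _ _ => rfl)

/-- In the basic coupling of ordered initial configurations, the order is preserved. -/
theorem IsBasicCoupling.ae_ne_true_false [IsProbabilityMeasure P]
    (h : IsBasicCoupling p q P η ζ Y Y') (hY : Y ⊆ Y') (hp : 0 ≤ p) (hq : 0 ≤ q)
    (hpq : p + q = 1) :
    ∀ᵐ ω ∂P, ∀ t x, pairConfig (η t ω) (ζ t ω) x ≠ (true, false) := by
  let f : ℤ → (ℤ → Bool × Bool) → ℝ := fun x σ => if σ x = (true, false) then 1 else 0
  have hdep : ∀ x, DependsOn (f x) (({x} : Finset ℤ) : Set ℤ) := by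
    intro x σ σ' hσ
    simp only [f]
    rw [hσ x (by simp)]
  have h0 : ∀ x σ, 0 ≤ f x σ := fun x σ => by
    simp only [f]
    split_ifs <;> norm_num
  have hinit : ∀ x, f x (pairConfig (configOf Y) (configOf Y')) = 0 := fun x => if_neg fun hx => by
    simp only [pairConfig, configOf, Prod.mk.injEq, decide_eq_true_eq, decide_eq_false_iff_not]
      at hx
    exact hx.2 (hY hx.1)
  have key : ∀ x, ∀ᵐ ω ∂P, ∀ t, f x (pairConfig (η t ω) (ζ t ω)) = 0 := fun x =>
    IsJumpProcess.ae_forall_eq_zero h (hdep x) fun t =>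
      IsJumpProcess.ae_eq_zero h isLocalRule_basicCouplingAttempt hp hq hpq f (fun x => {x}) 1
        (fun a b x => Equiv.swap a b x) hdep (fun x => (Finset.card_singleton x).le) h0
        (fun x σ => by
          simp only [f]
          split_ifs <;> norm_num)
        hinit
        (fun x a b σ => by
          by_cases hx : basicCouplingAttempt a b σ x = (true, false)
          · have h1 : f x (basicCouplingAttempt a b σ) = 1 := if_pos hx
            rw [h1]
            rcases basicCouplingAttempt_eq_true_false hx with h2 | h2
            · have h3 : f x σ = 1 := if_pos h2
              linarith [h0 (Equiv.swap a b x) σ]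
            · have h3 : f (Equiv.swap a b x) σ = 1 := if_pos h2
              linarith [h0 x σ]
          · have h1 : f x (basicCouplingAttempt a b σ) = 0 := if_neg hx
            rw [h1]
            exact add_nonneg (h0 _ _) (h0 _ _)) x t
  filter_upwards [ae_all_iff.2 key] with ω hω t x hx
  simpa [f, hx] using hω x t

lemma classifySite_comp_pairConfig_configOf :
    classifySite ∘ pairConfig (configOf Y) (configOf (insert 0 Y)) = secondClassAtOrigin Y := by
  funext x
  simp only [Function.comp_apply, classifySite, pairConfig, configOf, secondClassAtOrigin,
    decide_eq_true_eq, Set.mem_insert_iff]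
  split_ifs <;> simp_all

lemma coupleSite_comp_secondClassAtOrigin :
    coupleSite ∘ secondClassAtOrigin Y = pairConfig (configOf Y) (configOf (insert 0 Y)) := by
  funext x
  simp only [Function.comp_apply, coupleSite, pairConfig, configOf, secondClassAtOrigin,
    Set.mem_insert_iff]
  split_ifs <;> simp_all

theorem IsBasicCoupling.isSecondClassASEP [IsProbabilityMeasure P]
    (h : IsBasicCoupling p q P η ζ Y (insert 0 Y)) (hp : 0 ≤ p) (hq : 0 ≤ q)
    (hpq : p + q = 1) : IsSecondClassASEP p q P (fun t ω => classify (η t ω) (ζ t ω)) Y := by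
  have := IsJumpProcess.map h isLocalRule_twoClassAttempt classifySite <| by
    filter_upwards [h.ae_ne_true_false (Set.subset_insert 0 Y) hp hq hpq] with ω hω t x y
    exact classifySite_comp_basicCouplingAttempt (hω t) x y
  rw [classifySite_comp_pairConfig_configOf] at this
  exact this

lemma classify_eq_second_iff {η ζ : Config} {x : ℤ} :
    classify η ζ x = .second ↔ ζ x = true ∧ η x = false := by
  unfold classify
  split_ifs <;> simp_all

theorem IsSecondClassASEP.isBasicCoupling {ξ : ℝ≥0 → Ω → (ℤ → SiteState)}
    (h : IsSecondClassASEP p q P ξ Y) :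
    IsBasicCoupling p q P (fun t ω => firstClassConfig (ξ t ω))
      (fun t ω => occupiedConfig (ξ t ω)) Y (insert 0 Y) := by
  have := IsJumpProcess.map h isLocalRule_basicCouplingAttempt coupleSite
    (Eventually.of_forall fun ω t x y => coupleSite_comp_twoClassAttempt x y (ξ t ω))
  rw [coupleSite_comp_secondClassAtOrigin] at this
  exact this

/-- The probability that a site is occupied. -/
lemma IsASEP.meanAt_occupied (h : IsASEP p q P η Y) (t : ℝ≥0) (x : ℤ) :
    meanAt P η (fun σ => if σ x = true then 1 else 0) t = P.real {ω | η t ω x = true} := by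
  have hm : MeasurableSet {ω | η t ω x = true} :=
    (measurable_pi_apply x).comp (h.measurable t) (measurableSet_singleton true)
  rw [← integral_indicator_one hm, meanAt, Real.toNNReal_coe]
  refine integral_congr_ae (Eventually.of_forall fun ω => ?_)
  simp [Set.indicator_apply]

/-- The occupation probabilities of ASEP are determined by its initial configuration. -/
lemma IsASEP.measureReal_eq {Ω' : Type*} [MeasurableSpace Ω'] {P' : Measure Ω'}
    [IsProbabilityMeasure P] [IsProbabilityMeasure P'] {η' : ℝ≥0 → Ω' → Config}
    (h : IsASEP p q P η Y) (h' : IsASEP p q P' η' Y) (hp : 0 ≤ p) (hq : 0 ≤ q)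
    (hpq : p + q = 1) (t : ℝ≥0) (x : ℤ) :
    P.real {ω | η t ω x = true} = P'.real {ω | η' t ω x = true} := by
  have hdep : DependsOn (fun σ : Config => if σ x = true then (1 : ℝ) else 0)
      (({x} : Finset ℤ) : Set ℤ) := fun σ σ' hσ => by
    simp only
    rw [hσ x (by simp)]
  rw [← h.meanAt_occupied, ← h'.meanAt_occupied]
  exact IsJumpProcess.meanAt_eq h h' isLocalRule_exclusionAttempt hp hq hpq t.coe_nonneg hdep

end Coupling

theorem mainTheorem5 (p q : ℝ) (hp : 0 ≤ p) (hpq : p < q) (hq : q = 1 - p)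
    (Y : Set ℤ) (hY : ∀ y ∈ Y, 0 < y)
    {Ω : Type*} [MeasurableSpace Ω] (P : Measure Ω) [IsProbabilityMeasure P] :
    -- The discrepancy of two basically coupled ASEPs is a single second class particle.
    (∀ η ζ : ℝ≥0 → Ω → Config, IsBasicCoupling p q P η ζ Y (insert 0 Y) →
      IsASEP p q P η Y ∧ IsASEP p q P ζ (insert 0 Y) ∧
      (∀ᵐ ω ∂P, ∀ t, η t ω ≤ ζ t ω ∧ ∃! x : ℤ, ζ t ω x = true ∧ η t ω x = false) ∧
      IsSecondClassASEP p q P (fun t ω => classify (η t ω) (ζ t ω)) Y) ∧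
    -- Conversely, a single second class particle is the discrepancy of two basically coupled ASEPs.
    (∀ ξ : ℝ≥0 → Ω → (ℤ → SiteState), IsSecondClassASEP p q P ξ Y →
      IsBasicCoupling p q P (fun t ω => firstClassConfig (ξ t ω))
        (fun t ω => occupiedConfig (ξ t ω)) Y (insert 0 Y) ∧
      (∀ᵐ ω ∂P, ∀ t, ∃! x : ℤ, ξ t ω x = .second)) ∧
    -- The law of the position of the second class particle.
    (∀ (ξ : ℝ≥0 → Ω → (ℤ → SiteState)) (X : ℝ≥0 → Ω → ℤ),
      IsSecondClassASEP p q P ξ Y → (∀ t, ∀ᵐ ω ∂P, ξ t ω (X t ω) = .second) →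
      ∀ {Ω₁ Ω₂ : Type*} [MeasurableSpace Ω₁] [MeasurableSpace Ω₂]
        (P₁ : Measure Ω₁) (P₂ : Measure Ω₂) [IsProbabilityMeasure P₁] [IsProbabilityMeasure P₂]
        (η : ℝ≥0 → Ω₁ → Config) (ζ : ℝ≥0 → Ω₂ → Config),
        IsASEP p q P₁ η Y → IsASEP p q P₂ ζ (insert 0 Y) →
        ∀ (t : ℝ≥0) (x : ℤ),
          P.real {ω | X t ω = x} =
            P₂.real {ω | ζ t ω x = true} - P₁.real {ω | η t ω x = true}) := by
  have hY0 : (0 : ℤ) ∉ Y := fun h => lt_irrefl _ (hY 0 h)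
  have hq0 : 0 ≤ q := hp.trans hpq.le
  have hsum : p + q = 1 := by linarith
  refine ⟨fun η ζ h => ?_, fun ξ h => ⟨h.isBasicCoupling, h.ae_existsUnique hY0 hp hq0 hsum⟩,
    fun ξ X h hX Ω₁ Ω₂ _ _ P₁ P₂ _ _ η ζ hη hζ t x => ?_⟩
  · have h2 := h.isSecondClassASEP hp hq0 hsum
    refine ⟨h.isASEP_fst, h.isASEP_snd, ?_, h2⟩
    -- The single discrepancy is the single second class particle of the classified process.
    filter_upwards [h.ae_ne_true_false (Set.subset_insert 0 Y) hp hq0 hsum,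
      h2.ae_existsUnique hY0 hp hq0 hsum] with ω h3 h4 t
    refine ⟨fun x => ?_, by simpa only [classify_eq_second_iff] using h4 t⟩
    have h5 := h3 t x
    simp only [pairConfig, ne_eq, Prod.mk.injEq, not_and, Bool.not_eq_false] at h5
    exact h5
  · have hc := h.isBasicCoupling
    -- By uniqueness of marginals both ASEPs may be replaced by those built from `ξ` on one space,
    -- where the difference is the probability of a set difference.
    rw [← hc.isASEP_fst.measureReal_eq hη hp hq0 hsum t x,
      ← hc.isASEP_snd.measureReal_eq hζ hp hq0 hsum t x]
    have hm : ∀ s : Set SiteState, MeasurableSet {ω | ξ t ω x ∈ s} := fun s =>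
      (measurable_pi_apply x).comp (h.measurable t) (MeasurableSpace.measurableSet_top (s := s))
    rw [← measureReal_sdiff (fun ω hω => by simp_all [firstClassConfig, occupiedConfig])
      (by simpa [firstClassConfig] using hm {.first})]
    -- Almost sure equality of the events suffices, so `X` need not be measurable.
    refine measureReal_congr ?_
    filter_upwards [hX t, h.ae_unique hp hq0 hsum] with ω h1 h2
    refine propext ?_
    change X t ω = x ↔ occupiedConfig (ξ t ω) x = true ∧ ¬ firstClassConfig (ξ t ω) x = true
    constructor
    · rintro rfl
      simp [occupiedConfig, firstClassConfig, h1]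
    · rintro ⟨h3, h4⟩
      refine h2 t _ _ h1 ?_
      simp only [occupiedConfig, firstClassConfig, decide_eq_true_eq] at h3 h4
      cases hs : ξ t ω x <;> simp_all
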